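/- **Setting.** Let $K\ge 0$ be the number of arms, $d$ the dimension, and $X_1,\dots,X_K$ random vectors in $\mathbb{R}^d$ with finite second moments. The joint law of $(X_1,\dots,X_K)$ satisfies the *balanced covariance condition* with constant $C_{\mathcal X}\in\mathbb{R}$ if for every permutation $(i_1,\dots,i_K)$ of $(1,\dots,K)$, every $k\in\{2,\dots,K-1\}$ and every $\beta\in\mathbb{R}^d$, $$\mathbb{E}\big[X_{i_k}X_{i_k}^\top \mathbf 1\{X_{i_1}^\top\beta<\dots<X_{i_K}^\top\beta\}\big]\preccurlyeq C_{\mathcal X}\,\mathbb{E}\big[(X_{i_1}X_{i_1}^\top+X_{i_K}X_{i_K}^\top)\mathbf 1\{X_{i_1}^\top\beta<\dots<X_{i_K}^\top\beta\}\big]$$ in the Loewner order. **Proposition.** Suppose the arms $X_1,\dots,X_K$ are independent and identically distributed. 1. (Gaussian.) There is an absolute constant $C$ such that, for all $K$, $d$, every mean $m\in\mathbb{R}^d$ and every positive semidefinite covariance matrix $\Gamma\in\mathbb{R}^{d\times d}$, if $X_i\sim\mathcal N(m,\Gamma)$ then the balanced covariance condition holds with $C_{\mathcal X}=C$. 2.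 (Uniform on the sphere.) In the regime $K=o(d)$ one has $C_{\mathcal X}=\mathcal O(1)$: for every sequence $(K_d)_{d\ge 1}$ of numbers of arms with $K_d/d\to 0$ as $d\to\infty$ there is a constant $C$ such that, for every $d\ge 1$, the balanced covariance condition with $C_{\mathcal X}=C$ holds for $K_d$ independent arms distributed uniformly on the unit sphere of $\mathbb{R}^d$. 3. (Arbitrary distribution.) If the common law $\mu$ of the arms has a finite second moment and gives mass zero to every affine hyperplane $\{x: x^\top\beta=c\}$, $\beta\ne 0$, $c\in\mathbb{R}$ (in particular if it has a finite second moment and a density with respect to Lebesgue measure), then the balanced covariance condition holds with $C_{\mathcal X}=\binom{K-1}{K_0}$, where $K_0=\lceil (K-1)/2\rceil$. -/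

import Mathlib

open MeasureTheory

noncomputable section

namespace BalancedArms

/-- The event `{X_{σ(1)}ᵀβ < ⋯ < X_{σ(K)}ᵀβ}` in the space of `K`-tuples of arms in `ℝᵈ`. -/
def orderEvent {K d : ℕ} (σ : Equiv.Perm (Fin K)) (β : EuclideanSpace ℝ (Fin d)) :
    Set (Fin K → EuclideanSpace ℝ (Fin d)) :=
  {x | StrictMono fun j : Fin K => inner ℝ (x (σ j)) β}

/-- The outer product `v vᵀ`. -/
def outer {d : ℕ} (v : EuclideanSpace ℝ (Fin d)) : Matrix (Fin d) (Fin d) ℝ :=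
  Matrix.of fun a b => v a * v b

/-- `𝔼[M · 𝟙_A]` under `P`, for a random matrix `M` (entrywise integral over `A`). -/
def expectOn {S : Type*} [MeasurableSpace S] {d : ℕ} (P : Measure S) (A : Set S)
    (M : S → Matrix (Fin d) (Fin d) ℝ) : Matrix (Fin d) (Fin d) ℝ :=
  Matrix.of fun a b => ∫ x in A, M x a b ∂P

/-- The joint law `P` of the `K` arms satisfies the balanced covariance condition with constant
`C`: the arms have finite second moments (so that all expectations below exist), and for every
permutation `σ`, every position `k` that is neither the first nor the last, and every `β`,
`𝔼[X_{σ(k)} X_{σ(k)}ᵀ 𝟙_A] ≼ C 𝔼[(X_{σ(1)} X_{σ(1)}ᵀ + X_{σ(K)} X_{σ(K)}ᵀ) 𝟙_A]` in the Loewner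
order, where `A = {X_{σ(1)}ᵀβ < ⋯ < X_{σ(K)}ᵀβ}`. Positions are counted from `0`. -/
def BalancedCovariance {K d : ℕ} (P : Measure (Fin K → EuclideanSpace ℝ (Fin d))) (C : ℝ) :
    Prop :=
  (∀ i : Fin K, MemLp (fun x : Fin K → EuclideanSpace ℝ (Fin d) => x i) 2 P) ∧
  ∀ (σ : Equiv.Perm (Fin K)) (k : Fin K) (_ : 0 < (k : ℕ)) (hk : (k : ℕ) + 1 < K)
    (β : EuclideanSpace ℝ (Fin d)),
    (C • expectOn P (orderEvent σ β)
          (fun x => outer (x (σ ⟨0, by omega⟩)) + outer (x (σ ⟨K - 1, by omega⟩)))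
      - expectOn P (orderEvent σ β) (fun x => outer (x (σ k)))).PosSemidef

/-- The joint law of `K` independent arms with common law `μ`. -/
def iidArms {d : ℕ} (K : ℕ) (μ : Measure (EuclideanSpace ℝ (Fin d))) :
    Measure (Fin K → EuclideanSpace ℝ (Fin d)) :=
  Measure.pi fun _ : Fin K => μ

/-- The uniform distribution on the unit sphere of `ℝᵈ`, as a law on `ℝᵈ`: the normalized
surface measure (a probability measure for `d ≥ 1`). -/
def uniformSphere (d : ℕ) : Measure (EuclideanSpace ℝ (Fin d)) :=
  (((volume : Measure (EuclideanSpace ℝ (Fin d))).toSphere Set.univ)⁻¹ •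
    (volume : Measure (EuclideanSpace ℝ (Fin d))).toSphere).map Subtype.val

end BalancedArms

end

/-!
For arms with common law `μ` and a direction `β`, exchangeability reduces the Loewner inequality
for an arbitrary permutation to the scalar inequality `ScalarBalance`: on the event `A` that the
scores `Xⱼᵀβ` are increasing in `j`, the second moment of `Xₖᵀv` is at most `C` times the sum of the
second moments of `X₀ᵀv` and `Xₙᵀv`, for every `v` (`ScalarBalance.balancedCovariance`; there are
`n + 1` arms, numbered from `0`).

*Arbitrary laws.* Summing over the `(n + 1)!` equally likely orderings turns the restricted moment
of the arm in position `k` into a sum over the arms of rank `k`. Given the arm `a`, its rank is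
binomial, so up to a factor independent of `k` the moment is the integral of
`(aᵀv)² * choose n k * F ^ k * (1 - F) ^ (n - k)`, with `F` the distribution function of the scores
at `aᵀβ` (`factorial_mul_setLIntegral_eq`). The claim is then the pointwise bound
`F ^ k * (1 - F) ^ (n - k) ≤ (1 - F) ^ n + F ^ n`, together with the maximality of the central
binomial coefficient.

*Gaussian arms.* Write `Xᵀv = a + b Y + U`, with `Y` the centred score and `U` centred and
independent of `Y`. The moment in position `k` becomes
`𝔼[(a + b Yₖ)² 𝟙_A] + Var(U) ℙ(A)`. For the two extreme positions the cross terms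
`2 a b 𝔼[Y 𝟙_A]` cancel, since reflecting all arms through the mean and reversing their order
preserves the law and the event. Since `Yₖ` lies between `Y₀` and `Yₙ`,
also `Yₖ² ≤ Y₀² + Yₙ²`, and the constant `2` follows (`scalarBalance_of_decomposition`).

*Uniform arms on the sphere.* Split `v` into its part along `β` and a part `w` orthogonal to it.
Reflections fixing `β` remove the cross term and show that the moment in direction `w` is
`‖w‖² 𝔼[(1 - Zₖ²) 𝟙_A] / (d - 1)`, where `Z` is the score for normalized `β`
(`positionMoment_orthogonal`). The part along `β` is again controlled by `Zₖ² ≤ Z₀² + Zₙ²`. For the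
orthogonal part it is enough that `𝔼[Zⱼ² 𝟙_A] ≤ ℙ(A) / 2`; by symmetrization and `𝔼[Z²] = 1 / d` this
holds once there are at most `d / 2` arms, so that the constant `1` works
(`scalarBalance_uniformSphere_of_le`). Under `K = o(d)` this leaves finitely many dimensions, which
the bound for arbitrary laws covers when `d ≥ 2`, circular cones having volume zero, and which are
trivial when `d = 1`.
-/

namespace BalancedArms

open ProbabilityTheory Filter

/-! ### Reduction to scalar inequalities for the identity ordering -/

section Reduction

variable {d K n : ℕ} {μ : Measure (EuclideanSpace ℝ (Fin d))}

/-- The second moment in direction `v` of the arm `Xₖ`, restricted to the event that the scores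
`X₀ᵀβ < ⋯ < X_{K-1}ᵀβ` increase with the index, so that `Xₖ` occupies position `k`. -/
noncomputable def positionMoment (K : ℕ) (μ : Measure (EuclideanSpace ℝ (Fin d)))
    (β v : EuclideanSpace ℝ (Fin d)) (k : Fin K) : ℝ :=
  ∫ x in orderEvent 1 β, inner ℝ (x k) v ^ 2 ∂iidArms K μ

/-- The quadratic-form version of the balanced covariance condition for `n + 1` i.i.d. arms,
for the identity permutation only. -/
def ScalarBalance (n : ℕ) (μ : Measure (EuclideanSpace ℝ (Fin d))) (C : ℝ) : Prop :=
  ∀ k : Fin (n + 1), 0 < k → k < Fin.last n → ∀ β v : EuclideanSpace ℝ (Fin d), β ≠ 0 →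
    positionMoment (n + 1) μ β v k ≤
      C * (positionMoment (n + 1) μ β v 0 + positionMoment (n + 1) μ β v (Fin.last n))

lemma positionMoment_nonneg (β v : EuclideanSpace ℝ (Fin d)) (k : Fin K) :
    0 ≤ positionMoment K μ β v k :=
  integral_nonneg fun _ => sq_nonneg _

lemma ScalarBalance.mono {C C' : ℝ} (h : ScalarBalance n μ C) (hC : C ≤ C') :
    ScalarBalance n μ C' := fun k h0 hk β v hβ =>
  (h k h0 hk β v hβ).trans <| mul_le_mul_of_nonneg_right hC <|
    add_nonneg (positionMoment_nonneg ..) (positionMoment_nonneg ..)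

lemma measurableSet_orderEvent (σ : Equiv.Perm (Fin K)) (β : EuclideanSpace ℝ (Fin d)) :
    MeasurableSet (orderEvent σ β) := by
  have : orderEvent σ β = ⋂ (i : Fin K) (j : Fin K) (_ : i < j),
      {x | inner ℝ (x (σ i)) β < inner ℝ (x (σ j)) β} := by
    ext x
    simp only [orderEvent, StrictMono, Set.mem_ofPred_eq, Set.mem_iInter]
  rw [this]
  refine .iInter fun i => .iInter fun j => .iInter fun _ => ?_
  exact measurableSet_lt (by fun_prop) (by fun_prop)

instance [IsProbabilityMeasure μ] : IsProbabilityMeasure (iidArms K μ) := by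
  unfold iidArms; infer_instance

/-- I.i.d. arms are exchangeable. -/
lemma measurePreserving_permute [IsProbabilityMeasure μ] (σ : Equiv.Perm (Fin K)) :
    MeasurePreserving (MeasurableEquiv.arrowCongr' σ.symm
      (MeasurableEquiv.refl (EuclideanSpace ℝ (Fin d)))) (iidArms K μ) (iidArms K μ) :=
  measurePreserving_arrowCongr' (fun _ => μ) (fun _ => μ) σ.symm _ fun _ => .id μ

lemma setIntegral_orderEvent [IsProbabilityMeasure μ] (σ : Equiv.Perm (Fin K))
    (β : EuclideanSpace ℝ (Fin d)) (k : Fin K) (f : EuclideanSpace ℝ (Fin d) → ℝ) :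
    ∫ x in orderEvent σ β, f (x (σ k)) ∂iidArms K μ =
      ∫ x in orderEvent 1 β, f (x k) ∂iidArms K μ :=
  (measurePreserving_permute σ).setIntegral_preimage_emb
    (MeasurableEquiv.measurableEmbedding _) (fun x => f (x k)) (orderEvent 1 β)

lemma memLp_arm [IsProbabilityMeasure μ] (hμ : MemLp id 2 μ) (i : Fin K) :
    MemLp (fun x : Fin K → EuclideanSpace ℝ (Fin d) => x i) 2 (iidArms K μ) :=
  hμ.comp_measurePreserving (measurePreserving_eval (fun _ => μ) i)

lemma memLp_inner_arm [IsProbabilityMeasure μ] (hμ : MemLp id 2 μ) (i : Fin K)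
    (v : EuclideanSpace ℝ (Fin d)) :
    MemLp (fun x : Fin K → EuclideanSpace ℝ (Fin d) => inner ℝ (x i) v) 2 (iidArms K μ) :=
  (memLp_arm hμ i).inner_const v

lemma integrable_inner_arm_sq [IsProbabilityMeasure μ] (hμ : MemLp id 2 μ) (i : Fin K)
    (v : EuclideanSpace ℝ (Fin d)) :
    Integrable (fun x : Fin K → EuclideanSpace ℝ (Fin d) => inner ℝ (x i) v ^ 2) (iidArms K μ) :=
  (memLp_inner_arm hμ i v).integrable_sq

lemma expectOn_isSymm {S : Type*} [MeasurableSpace S] (P : Measure S) (A : Set S)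
    {M : S → Matrix (Fin d) (Fin d) ℝ} (hM : ∀ x, (M x).IsSymm) : (expectOn P A M).IsSymm := by
  ext a b
  simp only [expectOn, Matrix.transpose_apply, Matrix.of_apply]
  congr 1 with x
  exact (hM x).apply a b

lemma outer_isSymm (v : EuclideanSpace ℝ (Fin d)) : (outer v).IsSymm := by
  ext a b
  simp [outer, mul_comm]

lemma dotProduct_expectOn {S : Type*} [MeasurableSpace S] (P : Measure S) (A : Set S)
    {M : S → Matrix (Fin d) (Fin d) ℝ} (hM : ∀ a b, Integrable (fun x => M x a b) P)
    (v : Fin d → ℝ) :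
    v ⬝ᵥ (expectOn P A M).mulVec v = ∫ x in A, v ⬝ᵥ (M x).mulVec v ∂P := by
  simp only [dotProduct, Matrix.mulVec, expectOn, Matrix.of_apply]
  rw [integral_finsetSum]
  · refine Finset.sum_congr rfl fun a _ => ?_
    rw [integral_const_mul, integral_finsetSum]
    · simp_rw [integral_mul_const]
    · exact fun b _ => ((hM a b).mul_const _).restrict
  · exact fun a _ => ((integrable_finsetSum _ fun b _ => (hM a b).mul_const _).const_mul _).restrict

lemma dotProduct_outer (x : EuclideanSpace ℝ (Fin d)) (v : Fin d → ℝ) :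
    v ⬝ᵥ (outer x).mulVec v = inner ℝ x (WithLp.toLp 2 v) ^ 2 := by
  simp only [dotProduct, Matrix.mulVec, outer, Matrix.of_apply, PiLp.inner_apply,
    RCLike.inner_apply, conj_trivial]
  rw [sq, Finset.sum_mul_sum]
  refine Finset.sum_congr rfl fun a _ => ?_
  rw [Finset.mul_sum]
  refine Finset.sum_congr rfl fun b _ => ?_
  ring

lemma integrable_outer_arm [IsProbabilityMeasure μ] (hμ : MemLp id 2 μ) (i : Fin K)
    (a b : Fin d) :
    Integrable (fun x : Fin K → EuclideanSpace ℝ (Fin d) => outer (x i) a b) (iidArms K μ) := by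
  have h (c : Fin d) :
      MemLp (fun x : Fin K → EuclideanSpace ℝ (Fin d) => x i c) 2 (iidArms K μ) := by
    simpa [EuclideanSpace.inner_single_right] using memLp_inner_arm hμ i (EuclideanSpace.single c 1)
  exact (h a).integrable_mul (h b)

lemma orderEvent_zero (σ : Equiv.Perm (Fin (n + 1))) (hn : 0 < n) :
    orderEvent σ (0 : EuclideanSpace ℝ (Fin d)) = ∅ := by
  refine Set.eq_empty_of_forall_notMem fun x hx => ?_
  have : (0 : Fin (n + 1)) < Fin.last n := hn
  simpa using hx this

/-- By exchangeability, and by testing the Loewner inequality on vectors, the balanced covariance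
condition for i.i.d. arms reduces to a scalar inequality. -/
theorem ScalarBalance.balancedCovariance [IsProbabilityMeasure μ] (hμ : MemLp id 2 μ) {C : ℝ}
    (h : ScalarBalance n μ C) : BalancedCovariance (iidArms (n + 1) μ) C := by
  refine ⟨memLp_arm hμ, fun σ k h0 hk β => ?_⟩
  have hlast : (⟨n + 1 - 1, by omega⟩ : Fin (n + 1)) = Fin.last n := rfl
  have hzero : (⟨0, by omega⟩ : Fin (n + 1)) = 0 := rfl
  have hs := expectOn_isSymm (iidArms (n + 1) μ) (orderEvent σ β)
    (fun x => outer_isSymm (x (σ k)))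
  have hs' := expectOn_isSymm (iidArms (n + 1) μ) (orderEvent σ β)
    (fun x => (outer_isSymm (x (σ 0))).add (outer_isSymm (x (σ (Fin.last n)))))
  rw [hlast, hzero]
  refine .of_dotProduct_mulVec_nonneg ?_ fun v => ?_
  · rw [Matrix.IsHermitian, Matrix.conjTranspose_eq_transpose_of_trivial]
    exact (hs'.smul C).sub hs
  · have hmid := dotProduct_expectOn (iidArms (n + 1) μ) (orderEvent σ β)
      (integrable_outer_arm hμ (σ k)) v
    have hends := dotProduct_expectOn (iidArms (n + 1) μ) (orderEvent σ β)
      (M := fun x => outer (x (σ 0)) + outer (x (σ (Fin.last n))))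
      (fun a b => (integrable_outer_arm hμ (σ 0) a b).add (integrable_outer_arm hμ _ a b)) v
    simp only [Matrix.add_mulVec, dotProduct_add, dotProduct_outer] at hmid hends
    rw [integral_add (integrable_inner_arm_sq hμ _ _).restrict
      (integrable_inner_arm_sq hμ _ _).restrict] at hends
    rw [star_trivial, Matrix.sub_mulVec, dotProduct_sub, Matrix.smul_mulVec, dotProduct_smul,
      hmid, hends, sub_nonneg, smul_eq_mul]
    rcases eq_or_ne β 0 with rfl | hβ
    · simp [orderEvent_zero σ (show 0 < n by omega)]
    · have key := h k h0 (show (k : ℕ) < n by omega) β (WithLp.toLp 2 v) hβ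
      have hperm (j : Fin (n + 1)) := setIntegral_orderEvent (μ := μ) σ β j
        (fun y => inner ℝ y (WithLp.toLp 2 v) ^ 2)
      rw [hperm k, hperm 0, hperm (Fin.last n)]
      exact key

lemma balancedCovariance_zero_arms (μ : Measure (EuclideanSpace ℝ (Fin d))) (C : ℝ) :
    BalancedCovariance (iidArms 0 μ) C :=
  ⟨fun i => i.elim0, fun _ k => k.elim0⟩

end Reduction

/-! ### Symmetrization over the orderings -/

section Symmetrization

variable {d K n : ℕ} {μ : Measure (EuclideanSpace ℝ (Fin d))} [IsProbabilityMeasure μ]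

open scoped ENNReal

/-- The law `μ` charges no hyperplane orthogonal to `β`; equivalently, the scores `Xᵢᵀβ` have an
atomless law. -/
def ChargesNoLevel (μ : Measure (EuclideanSpace ℝ (Fin d))) (β : EuclideanSpace ℝ (Fin d)) : Prop :=
  ∀ c : ℝ, μ {x | inner ℝ x β = c} = 0

lemma measurable_comp_arm {h : EuclideanSpace ℝ (Fin d) → ℝ≥0∞} (hh : Measurable h) (i : Fin K) :
    Measurable fun x : Fin K → EuclideanSpace ℝ (Fin d) => h (x i) :=
  hh.comp (measurable_pi_apply i)

/-- Averaging over all permutations removes the ordering event. -/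
lemma factorial_mul_setLIntegral (β : EuclideanSpace ℝ (Fin d)) {h : EuclideanSpace ℝ (Fin d) → ℝ≥0∞}
    (hh : Measurable h) (k : Fin K) :
    (K.factorial : ℝ≥0∞) * ∫⁻ x in orderEvent 1 β, h (x k) ∂iidArms K μ =
      ∫⁻ x, ∑ σ : Equiv.Perm (Fin K), (orderEvent σ β).indicator (fun x => h (x (σ k))) x
        ∂iidArms K μ := by
  rw [lintegral_finsetSum]
  · have (σ : Equiv.Perm (Fin K)) :
        ∫⁻ x, (orderEvent σ β).indicator (fun x => h (x (σ k))) x ∂iidArms K μ =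
          ∫⁻ x in orderEvent 1 β, h (x k) ∂iidArms K μ := by
      rw [lintegral_indicator (measurableSet_orderEvent σ β)]
      exact (measurePreserving_permute σ).setLIntegral_comp_preimage_emb
        (MeasurableEquiv.measurableEmbedding _) (fun x => h (x k)) (orderEvent 1 β)
    simp [this, Fintype.card_perm]
  · exact fun σ _ => (measurable_comp_arm hh (σ k)).indicator (measurableSet_orderEvent σ β)

lemma exists_mem_orderEvent {x : Fin K → EuclideanSpace ℝ (Fin d)} {β : EuclideanSpace ℝ (Fin d)}
    (hx : Function.Injective fun i => inner ℝ (x i) β) : ∃ σ, x ∈ orderEvent σ β :=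
  ⟨Tuple.sort fun i => inner ℝ (x i) β,
    (Tuple.monotone_sort _).strictMono_of_injective (hx.comp (Equiv.injective _))⟩

lemma orderEvent_unique {x : Fin K → EuclideanSpace ℝ (Fin d)} {β : EuclideanSpace ℝ (Fin d)}
    (hx : Function.Injective fun i => inner ℝ (x i) β) {σ τ : Equiv.Perm (Fin K)}
    (hσ : x ∈ orderEvent σ β) (hτ : x ∈ orderEvent τ β) : σ = τ := by
  have h := (StrictMono.range_inj (f := fun j => inner ℝ (x (σ j)) β)
    (g := fun j => inner ℝ (x (τ j)) β) hσ hτ).1 <| by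
      exact (EquivLike.range_comp (fun i => inner ℝ (x i) β) σ).trans
        (EquivLike.range_comp (fun i => inner ℝ (x i) β) τ).symm
  ext j
  exact congrArg Fin.val (hx (congrFun h j))

lemma sum_indicator_orderEvent {x : Fin K → EuclideanSpace ℝ (Fin d)}
    {β : EuclideanSpace ℝ (Fin d)} (hx : Function.Injective fun i => inner ℝ (x i) β)
    {σ : Equiv.Perm (Fin K)} (hσ : x ∈ orderEvent σ β)
    (f : Equiv.Perm (Fin K) → (Fin K → EuclideanSpace ℝ (Fin d)) → ℝ≥0∞) :
    ∑ τ, (orderEvent τ β).indicator (f τ) x = f σ x := by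
  rw [Finset.sum_eq_single σ, Set.indicator_of_mem hσ]
  · exact fun τ _ hτ => Set.indicator_of_notMem (fun h => hτ (orderEvent_unique hx h hσ)) _
  · simp

/-- The number of arms with a score below that of arm `i`. -/
noncomputable def rank (β : EuclideanSpace ℝ (Fin d)) (i : Fin K)
    (x : Fin K → EuclideanSpace ℝ (Fin d)) : ℕ :=
  (Finset.univ.filter fun j => inner ℝ (x j) β < inner ℝ (x i) β).card

lemma rank_of_mem_orderEvent {x : Fin K → EuclideanSpace ℝ (Fin d)}
    {β : EuclideanSpace ℝ (Fin d)} {σ : Equiv.Perm (Fin K)} (hσ : x ∈ orderEvent σ β)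
    (m : Fin K) : rank β (σ m) x = m := by
  have : (Finset.univ.filter fun j => inner ℝ (x j) β < inner ℝ (x (σ m)) β) =
      (Finset.Iio m).map σ.toEmbedding := by
    ext j
    simp only [Finset.mem_filter, Finset.mem_univ, true_and, Finset.mem_map_equiv, Finset.mem_Iio]
    have := (show StrictMono fun j => inner ℝ (x (σ j)) β from hσ).lt_iff_lt (a := σ.symm j) (b := m)
    simpa using this
  rw [rank, this, Finset.card_map, Fin.card_Iio]

/-- Among arms with distinct scores, exactly one has rank `k`. -/
lemma sum_indicator_rank {x : Fin K → EuclideanSpace ℝ (Fin d)}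
    {β : EuclideanSpace ℝ (Fin d)} {σ : Equiv.Perm (Fin K)} (hσ : x ∈ orderEvent σ β) (k : Fin K)
    (h : EuclideanSpace ℝ (Fin d) → ℝ≥0∞) :
    ∑ i, {x | rank β i x = k}.indicator (fun x => h (x i)) x = h (x (σ k)) := by
  rw [Finset.sum_eq_single (σ k), Set.indicator_of_mem]
  · exact rank_of_mem_orderEvent hσ k
  · intro i _ hi
    refine Set.indicator_of_notMem (fun hmem => hi ?_) _
    have := rank_of_mem_orderEvent hσ (σ.symm i)
    rw [Equiv.apply_symm_apply, show rank β i x = k from hmem] at this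
    rw [Fin.ext this, Equiv.apply_symm_apply]
  · simp

lemma ae_injective {β : EuclideanSpace ℝ (Fin d)} (hβ : ChargesNoLevel μ β) :
    ∀ᵐ x ∂iidArms K μ, Function.Injective fun i => inner ℝ (x i) β := by
  have key (i j : Fin K) (hij : i ≠ j) :
      ∀ᵐ x ∂iidArms K μ, inner ℝ (x i) β ≠ inner ℝ (x j) β := by
    obtain _ | n := K
    · exact i.elim0
    obtain ⟨l, rfl⟩ := Fin.exists_succAbove_eq hij.symm
    have hmeas : MeasurableSet {p : EuclideanSpace ℝ (Fin d) ×
        (Fin n → EuclideanSpace ℝ (Fin d)) | inner ℝ p.1 β ≠ inner ℝ (p.2 l) β} :=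
      (measurableSet_eq_fun (by fun_prop) (by fun_prop)).compl
    have hprod : ∀ᵐ p ∂μ.prod (Measure.pi fun _ : Fin n => μ),
        inner ℝ p.1 β ≠ inner ℝ (p.2 l) β := by
      rw [Measure.ae_prod_iff_ae_ae hmeas]
      refine .of_forall fun a => ?_
      have := Measure.pi_eval_preimage_null (fun _ : Fin n => μ) (i := l) (hβ (inner ℝ a β))
      rw [ae_iff]
      convert! this using 2
      ext y
      simp [eq_comm]
    exact (measurePreserving_piFinSuccAbove (fun _ : Fin (n + 1) => μ) i).quasiMeasurePreserving.ae
      hprod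
  have : ∀ᵐ x ∂iidArms K μ, ∀ i j, i ≠ j → inner ℝ (x i) β ≠ inner ℝ (x j) β := by
    rw [ae_all_iff]; intro i
    rw [ae_all_iff]; intro j
    rcases eq_or_ne i j with h | h
    · simp [h]
    · filter_upwards [key i j h] with x hx _ using hx
  filter_upwards [this] with x hx i j hij
  by_contra hne
  exact hx i j hne hij

/-- All orderings of the arms are equally likely. -/
lemma factorial_mul_measure_orderEvent {β : EuclideanSpace ℝ (Fin d)} (hβ : ChargesNoLevel μ β)
    (k : Fin K) : (K.factorial : ℝ≥0∞) * iidArms K μ (orderEvent 1 β) = 1 := by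
  have := factorial_mul_setLIntegral (μ := μ) β (h := fun _ => 1) measurable_const k
  rw [setLIntegral_one] at this
  rw [this, lintegral_congr_ae (g := fun _ => 1)]
  · simp
  · filter_upwards [ae_injective hβ] with x hx
    obtain ⟨σ, hσ⟩ := exists_mem_orderEvent hx
    exact sum_indicator_orderEvent hx hσ _

/-- A crude union bound for the arm in a given position. -/
lemma factorial_mul_setLIntegral_le {β : EuclideanSpace ℝ (Fin d)} (hβ : ChargesNoLevel μ β)
    {h : EuclideanSpace ℝ (Fin d) → ℝ≥0∞} (hh : Measurable h) (k : Fin K) :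
    (K.factorial : ℝ≥0∞) * ∫⁻ x in orderEvent 1 β, h (x k) ∂iidArms K μ ≤ K * ∫⁻ y, h y ∂μ := by
  have hK : (K : ℝ≥0∞) * ∫⁻ y, h y ∂μ = ∫⁻ x, ∑ i : Fin K, h (x i) ∂iidArms K μ := by
    rw [lintegral_finsetSum _ fun i _ => measurable_comp_arm hh i]
    have (i : Fin K) : ∫⁻ x, h (x i) ∂iidArms K μ = ∫⁻ y, h y ∂μ :=
      (measurePreserving_eval (fun _ : Fin K => μ) i).lintegral_comp hh
    simp [this]
  rw [factorial_mul_setLIntegral β hh, hK]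
  refine lintegral_mono_ae ?_
  filter_upwards [ae_injective hβ] with x hx
  obtain ⟨σ, hσ⟩ := exists_mem_orderEvent hx
  rw [sum_indicator_orderEvent hx hσ]
  exact Finset.single_le_sum (f := fun i => h (x i)) (fun _ _ => zero_le) (Finset.mem_univ _)

/-- The probability that exactly `k` out of `n` independent points fall in `B`. -/
lemma pi_card_filter_eq {α : Type*} [MeasurableSpace α] (ν : Measure α) [SigmaFinite ν]
    {B : Set α} [DecidablePred (· ∈ B)] (hB : MeasurableSet B) (n k : ℕ) :
    (Measure.pi fun _ : Fin n => ν) {x | (Finset.univ.filter fun j => x j ∈ B).card = k} =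
      n.choose k * (ν B ^ k * ν Bᶜ ^ (n - k)) := by
  have hset (L : Finset (Fin n)) : {x : Fin n → α | (Finset.univ.filter fun j => x j ∈ B) = L} =
      Set.univ.pi fun j => if j ∈ L then B else Bᶜ := by
    ext x
    simp only [Set.mem_ofPred_eq, Finset.ext_iff, Finset.mem_filter, Finset.mem_univ, true_and,
      Set.mem_pi, Set.mem_univ, forall_const]
    refine forall_congr' fun j => ?_
    split_ifs with hj <;> simp [hj]
  have hU : {x : Fin n → α | (Finset.univ.filter fun j => x j ∈ B).card = k} =
      ⋃ L ∈ Finset.powersetCard k (Finset.univ : Finset (Fin n)),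
        {x : Fin n → α | (Finset.univ.filter fun j => x j ∈ B) = L} := by
    ext x
    simp [Finset.mem_powersetCard]
  rw [hU, measure_biUnion_finset]
  · have (L) (hL : L ∈ Finset.powersetCard k (Finset.univ : Finset (Fin n))) :
        (Measure.pi fun _ : Fin n => ν) {x | (Finset.univ.filter fun j => x j ∈ B) = L} =
          ν B ^ k * ν Bᶜ ^ (n - k) := by
      have hc := (Finset.mem_powersetCard.1 hL).2
      rw [hset, Measure.pi_pi]
      simp_rw [apply_ite ν]
      rw [Finset.prod_ite, Finset.prod_const, Finset.prod_const, Finset.filter_mem_eq_inter,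
        Finset.univ_inter, hc, Finset.filter_notMem_eq_sdiff, ← Finset.compl_eq_univ_sdiff,
        Finset.card_compl, hc, Fintype.card_fin]
    rw [Finset.sum_congr rfl this]
    simp
  · intro L _ L' _ hne
    refine Set.disjoint_left.2 fun x hx hx' => hne ?_
    exact Eq.trans (Eq.symm hx) hx'
  · intro L _
    rw [hset]
    refine .univ_pi fun j => ?_
    split_ifs
    exacts [hB, hB.compl]

lemma rank_eq_card_succAbove (β : EuclideanSpace ℝ (Fin d)) (i : Fin (n + 1))
    (x : Fin (n + 1) → EuclideanSpace ℝ (Fin d)) :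
    rank β i x =
      (Finset.univ.filter fun j => inner ℝ (x (i.succAbove j)) β < inner ℝ (x i) β).card := by
  rw [rank, Fin.univ_succAbove n i, Finset.filter_cons, if_neg (lt_irrefl _),
    Finset.filter_map, Finset.card_map]
  rfl

lemma measurable_rank (β : EuclideanSpace ℝ (Fin d)) (i : Fin K) : Measurable (rank β i) := by
  have : rank β i = fun x => ∑ j : Fin K,
      {x : Fin K → EuclideanSpace ℝ (Fin d) | inner ℝ (x j) β < inner ℝ (x i) β}.indicator 1 x := by
    ext x
    rw [rank, Finset.card_filter]
    rfl
  rw [this]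
  exact Finset.measurable_sum _ fun j _ => measurable_one.indicator
    (measurableSet_lt (by fun_prop) (by fun_prop))

lemma measurable_indicator_rank (β : EuclideanSpace ℝ (Fin d))
    {h : EuclideanSpace ℝ (Fin d) → ℝ≥0∞} (hh : Measurable h) (i : Fin K) (k : ℕ) :
    Measurable ({x : Fin K → EuclideanSpace ℝ (Fin d) | rank β i x = k}.indicator
      fun x => h (x i)) :=
  (measurable_comp_arm hh i).indicator (measurable_rank β i (measurableSet_singleton k))

/-- Conditioning on arm `i`, its rank is binomially distributed. -/
lemma lintegral_indicator_rank (β : EuclideanSpace ℝ (Fin d)) {h : EuclideanSpace ℝ (Fin d) → ℝ≥0∞}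
    (hh : Measurable h) (i : Fin (n + 1)) (k : ℕ) :
    ∫⁻ x, {x | rank β i x = k}.indicator (fun x => h (x i)) x ∂iidArms (n + 1) μ =
      n.choose k * ∫⁻ a, h a * (μ {y | inner ℝ y β < inner ℝ a β} ^ k *
        μ {y | inner ℝ y β < inner ℝ a β}ᶜ ^ (n - k)) ∂μ := by
  classical
  have hf := measurable_indicator_rank (K := n + 1) β hh i k
  have hmp := (measurePreserving_piFinSuccAbove (fun _ : Fin (n + 1) => μ) i).symm
  rw [show iidArms (n + 1) μ = Measure.pi fun _ => μ from rfl, ← hmp.lintegral_comp hf,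
    lintegral_prod (fun p => Set.indicator _ _ (_ : Fin (n + 1) → EuclideanSpace ℝ (Fin d)))
      (hf.comp hmp.measurable).aemeasurable]
  have hB (a : EuclideanSpace ℝ (Fin d)) :
      MeasurableSet {y : EuclideanSpace ℝ (Fin d) | inner ℝ y β < inner ℝ a β} :=
    measurableSet_lt (by fun_prop) (by fun_prop)
  have hinner (a : EuclideanSpace ℝ (Fin d)) :
      ∫⁻ x', {x : Fin (n + 1) → EuclideanSpace ℝ (Fin d) | rank β i x = k}.indicator
        (fun x => h (x i)) ((MeasurableEquiv.piFinSuccAbove (fun _ => EuclideanSpace ℝ (Fin d))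
          i).symm (a, x')) ∂(Measure.pi fun _ : Fin n => μ) =
      n.choose k * (h a * (μ {y | inner ℝ y β < inner ℝ a β} ^ k *
        μ {y | inner ℝ y β < inner ℝ a β}ᶜ ^ (n - k))) := by
    have hpt (x' : Fin n → EuclideanSpace ℝ (Fin d)) :
        {x : Fin (n + 1) → EuclideanSpace ℝ (Fin d) | rank β i x = k}.indicator
          (fun x => h (x i)) ((MeasurableEquiv.piFinSuccAbove (fun _ => EuclideanSpace ℝ (Fin d))
            i).symm (a, x')) =
        {x' : Fin n → EuclideanSpace ℝ (Fin d) | (Finset.univ.filter fun j => x' j ∈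
          {y : EuclideanSpace ℝ (Fin d) | inner ℝ y β < inner ℝ a β}).card = k}.indicator
            (fun _ => h a) x' := by
      have hsame : (MeasurableEquiv.piFinSuccAbove (fun _ => EuclideanSpace ℝ (Fin d)) i).symm
          (a, x') i = a := Fin.insertNth_apply_same (α := fun _ => EuclideanSpace ℝ (Fin d)) i a x'
      have hsucc (j : Fin n) : (MeasurableEquiv.piFinSuccAbove (fun _ => EuclideanSpace ℝ (Fin d))
          i).symm (a, x') (i.succAbove j) = x' j :=
        Fin.insertNth_apply_succAbove (α := fun _ => EuclideanSpace ℝ (Fin d)) i a x' j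
      simp only [Set.indicator_apply, Set.mem_ofPred_eq, rank_eq_card_succAbove, hsame, hsucc]
    simp_rw [hpt]
    rw [lintegral_indicator_const₀, pi_card_filter_eq μ (hB a)]
    · ring
    · have : Measurable fun x' : Fin n → EuclideanSpace ℝ (Fin d) => (Finset.univ.filter fun j =>
          x' j ∈ {y : EuclideanSpace ℝ (Fin d) | inner ℝ y β < inner ℝ a β}).card := by
        simp_rw [Finset.card_filter]
        exact Finset.measurable_sum _ fun j _ => Measurable.ite
          ((hB a).preimage (measurable_pi_apply j)) measurable_const measurable_const
      exact (this (measurableSet_singleton k)).nullMeasurableSet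
  simp_rw [hinner]
  rw [lintegral_const_mul' _ _ (by simp)]

/-- The law of the arm in position `k`, expressed through the distribution function of the scores:
the weight at `a` is a binomial probability. -/
lemma factorial_mul_setLIntegral_eq {β : EuclideanSpace ℝ (Fin d)} (hβ : ChargesNoLevel μ β)
    {h : EuclideanSpace ℝ (Fin d) → ℝ≥0∞} (hh : Measurable h) (k : Fin (n + 1)) :
    ((n + 1).factorial : ℝ≥0∞) * ∫⁻ x in orderEvent 1 β, h (x k) ∂iidArms (n + 1) μ =
      (n + 1) * (n.choose k * ∫⁻ a, h a * (μ {y | inner ℝ y β < inner ℝ a β} ^ (k : ℕ) *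
        μ {y | inner ℝ y β < inner ℝ a β}ᶜ ^ (n - k)) ∂μ) := by
  rw [factorial_mul_setLIntegral β hh]
  have : ∫⁻ x, ∑ σ : Equiv.Perm (Fin (n + 1)),
      (orderEvent σ β).indicator (fun x => h (x (σ k))) x ∂iidArms (n + 1) μ =
      ∫⁻ x, ∑ i, {x | rank β i x = k}.indicator (fun x => h (x i)) x ∂iidArms (n + 1) μ := by
    refine lintegral_congr_ae ?_
    filter_upwards [ae_injective hβ] with x hx
    obtain ⟨σ, hσ⟩ := exists_mem_orderEvent hx
    rw [sum_indicator_orderEvent hx hσ, sum_indicator_rank hσ]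
  rw [this, lintegral_finsetSum _ fun i _ => measurable_indicator_rank β hh i k]
  simp [lintegral_indicator_rank β hh]

end Symmetrization

/-! ### Arbitrary laws without mass on hyperplanes -/

section Arbitrary

variable {d K n : ℕ} {μ : Measure (EuclideanSpace ℝ (Fin d))} [IsProbabilityMeasure μ]

open scoped ENNReal

lemma ofReal_positionMoment (hμ : MemLp id 2 μ) (β v : EuclideanSpace ℝ (Fin d)) (k : Fin K) :
    ENNReal.ofReal (positionMoment K μ β v k) =
      ∫⁻ x in orderEvent 1 β, ENNReal.ofReal (inner ℝ (x k) v ^ 2) ∂iidArms K μ :=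
  ofReal_integral_eq_lintegral_ofReal (integrable_inner_arm_sq hμ k v).restrict
    (.of_forall fun _ => sq_nonneg _)

lemma pow_mul_pow_le_pow_add_pow {R : Type*} [CommSemiring R] [LinearOrder R] [CanonicallyOrderedAdd R]
    [IsOrderedRing R] (a b : R) {k n : ℕ} (hk : k ≤ n) :
    a ^ k * b ^ (n - k) ≤ b ^ n + a ^ n := by
  rcases le_total a b with h | h
  · calc a ^ k * b ^ (n - k) ≤ b ^ k * b ^ (n - k) := by gcongr
      _ = b ^ n := pow_mul_pow_sub b hk
      _ ≤ b ^ n + a ^ n := le_self_add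
  · calc a ^ k * b ^ (n - k) ≤ a ^ k * a ^ (n - k) := by gcongr
      _ = a ^ n := pow_mul_pow_sub a hk
      _ ≤ b ^ n + a ^ n := le_add_self

lemma choose_le_choose_ceil_half (n k : ℕ) : n.choose k ≤ n.choose ⌈(n : ℝ) / 2⌉₊ := by
  have h : ⌈(n : ℝ) / 2⌉₊ = n - n / 2 := by
    obtain ⟨m, rfl | rfl⟩ := n.even_or_odd'
    · rw [Nat.cast_mul, Nat.cast_ofNat, mul_div_cancel_left₀ _ two_ne_zero, Nat.ceil_natCast]
      omega
    · rw [show 2 * m + 1 - (2 * m + 1) / 2 = m + 1 by omega, Nat.ceil_eq_iff m.succ_ne_zero]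
      push_cast [Nat.add_sub_cancel]
      constructor <;> linarith
  rw [h, Nat.choose_symm (Nat.div_le_self n 2)]
  exact Nat.choose_le_middle k n

/-- In terms of the distribution function `F` of the scores, the binomial weight
`F ^ k * (1 - F) ^ (n - k)` of a middle position is at most the sum of the weights
`(1 - F) ^ n` and `F ^ n` of the two extreme positions. -/
theorem scalarBalance_of_chargesNoLevel (hμ : MemLp id 2 μ)
    (hlevel : ∀ β : EuclideanSpace ℝ (Fin d), β ≠ 0 → ChargesNoLevel μ β) (n : ℕ) :
    ScalarBalance n μ (n.choose ⌈(n : ℝ) / 2⌉₊) := by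
  intro k _ _ β v hβ
  set h : EuclideanSpace ℝ (Fin d) → ℝ≥0∞ := fun y => ENNReal.ofReal (inner ℝ y v ^ 2)
  have hh : Measurable h := by fun_prop
  set F : EuclideanSpace ℝ (Fin d) → ℝ≥0∞ := fun a => μ {y | inner ℝ y β < inner ℝ a β}
  set G : EuclideanSpace ℝ (Fin d) → ℝ≥0∞ := fun a => μ {y | inner ℝ y β < inner ℝ a β}ᶜ
  have hpos (j : Fin (n + 1)) : ((n + 1).factorial : ℝ≥0∞) *
      ENNReal.ofReal (positionMoment (n + 1) μ β v j) =
        (n + 1) * (n.choose j * ∫⁻ a, h a * (F a ^ (j : ℕ) * G a ^ (n - j)) ∂μ) := by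
    rw [ofReal_positionMoment hμ]
    exact factorial_mul_setLIntegral_eq (hlevel β hβ) hh j
  have hGm : Measurable G := measurable_measure_prodMk_left (ν := μ)
    (s := {p : EuclideanSpace ℝ (Fin d) × EuclideanSpace ℝ (Fin d) |
      inner ℝ p.2 β < inner ℝ p.1 β}ᶜ) (measurableSet_lt (by fun_prop) (by fun_prop)).compl
  have hsum : ∫⁻ a, h a * (F a ^ (k : ℕ) * G a ^ (n - k)) ∂μ ≤
      ∫⁻ a, h a * (G a ^ n) ∂μ + ∫⁻ a, h a * (F a ^ n) ∂μ := by
    rw [← lintegral_add_left (by fun_prop)]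
    refine lintegral_mono fun a => ?_
    rw [← mul_add]
    gcongr
    exact pow_mul_pow_le_pow_add_pow _ _ k.is_le
  have h0 := hpos 0
  have hn := hpos (Fin.last n)
  simp only [Fin.val_zero, Fin.val_last, Nat.choose_zero_right, Nat.choose_self, pow_zero, one_mul,
    mul_one, Nat.cast_one, Nat.sub_zero, Nat.sub_self] at h0 hn
  have hfac0 : ((n + 1).factorial : ℝ≥0∞) ≠ 0 := by exact_mod_cast (n + 1).factorial_ne_zero
  have hfac : ((n + 1).factorial : ℝ≥0∞) ≠ ⊤ := ENNReal.natCast_ne_top _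
  have hC : (n.choose k : ℝ≥0∞) ≤ n.choose ⌈(n : ℝ) / 2⌉₊ := by
    exact_mod_cast choose_le_choose_ceil_half n k
  have hmain : ENNReal.ofReal (positionMoment (n + 1) μ β v k) ≤ n.choose ⌈(n : ℝ) / 2⌉₊ *
      (ENNReal.ofReal (positionMoment (n + 1) μ β v 0) +
        ENNReal.ofReal (positionMoment (n + 1) μ β v (Fin.last n))) := by
    rw [← ENNReal.mul_le_mul_iff_right hfac0 hfac, hpos k,
      mul_left_comm ((n + 1).factorial : ℝ≥0∞), mul_add ((n + 1).factorial : ℝ≥0∞), h0, hn,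
      ← mul_add, mul_left_comm _ (n + 1 : ℝ≥0∞)]
    gcongr
  have hp := positionMoment_nonneg (μ := μ) (K := n + 1) β v
  rw [← ENNReal.ofReal_add (hp _) (hp _), ← ENNReal.ofReal_natCast,
    ← ENNReal.ofReal_mul (Nat.cast_nonneg _), ENNReal.ofReal_le_ofReal_iff
      (mul_nonneg (Nat.cast_nonneg _) (add_nonneg (hp _) (hp _)))] at hmain
  exact hmain

end Arbitrary

/-! ### Gaussian arms -/

section Gaussian

variable {d K n : ℕ} {μ : Measure (EuclideanSpace ℝ (Fin d))} [IsProbabilityMeasure μ]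

/-- If two features `Y`, `U` of one arm are independent, then the families of these features over
all the i.i.d. arms are independent. -/
lemma indepFun_arms {Y U : EuclideanSpace ℝ (Fin d) → ℝ} (hY : Measurable Y) (hU : Measurable U)
    (h : IndepFun Y U μ) :
    IndepFun (fun (x : Fin K → EuclideanSpace ℝ (Fin d)) i => Y (x i)) (fun x i => U (x i))
      (iidArms K μ) := by
  have := Measure.isProbabilityMeasure_map (μ := μ) hY.aemeasurable
  have := Measure.isProbabilityMeasure_map (μ := μ) hU.aemeasurable
  have hYm : Measurable fun (x : Fin K → EuclideanSpace ℝ (Fin d)) i => Y (x i) := by fun_prop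
  have hUm : Measurable fun (x : Fin K → EuclideanSpace ℝ (Fin d)) i => U (x i) := by fun_prop
  rw [indepFun_iff_map_prod_eq_prod_map_map hYm.aemeasurable hUm.aemeasurable]
  have h1 : MeasurePreserving (fun (x : Fin K → EuclideanSpace ℝ (Fin d)) i => (Y (x i), U (x i)))
      (iidArms K μ) (Measure.pi fun _ => (μ.map Y).prod (μ.map U)) :=
    measurePreserving_pi _ _ (f := fun _ y => (Y y, U y)) fun _ => ⟨hY.prodMk hU,
      (indepFun_iff_map_prod_eq_prod_map_map hY.aemeasurable hU.aemeasurable).1 h⟩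
  have h2 := (measurePreserving_arrowProdEquivProdArrow ℝ ℝ (Fin K) (fun _ => μ.map Y)
    (fun _ => μ.map U)).comp h1
  have h3 : MeasurePreserving (fun (x : Fin K → EuclideanSpace ℝ (Fin d)) i => Y (x i))
      (iidArms K μ) (Measure.pi fun _ => μ.map Y) :=
    measurePreserving_pi _ _ (f := fun _ => Y) fun _ => hY.measurePreserving μ
  have h4 : MeasurePreserving (fun (x : Fin K → EuclideanSpace ℝ (Fin d)) i => U (x i))
      (iidArms K μ) (Measure.pi fun _ => μ.map U) :=
    measurePreserving_pi _ _ (f := fun _ => U) fun _ => hU.measurePreserving μ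
  rw [h3.map_eq, h4.map_eq]
  exact h2.map_eq

lemma setIntegral_mul_of_indep {Y U : EuclideanSpace ℝ (Fin d) → ℝ} (hY : Measurable Y)
    (hU : Measurable U) (h : IndepFun Y U μ) {S : Set (Fin K → ℝ)} (hS : MeasurableSet S)
    {φ ψ : ℝ → ℝ} (hφ : Measurable φ) (hψ : Measurable ψ) (k : Fin K) :
    ∫ x in {x | (fun i => Y (x i)) ∈ S}, φ (Y (x k)) * ψ (U (x k)) ∂iidArms K μ =
      (∫ x in {x | (fun i => Y (x i)) ∈ S}, φ (Y (x k)) ∂iidArms K μ) * ∫ y, ψ (U y) ∂μ := by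
  have hSm : MeasurableSet {x : Fin K → EuclideanSpace ℝ (Fin d) | (fun i => Y (x i)) ∈ S} :=
    hS.preimage (by fun_prop)
  have hX : Measurable (S.indicator fun y : Fin K → ℝ => φ (y k)) :=
    (hφ.comp (measurable_pi_apply k)).indicator hS
  have hind := (indepFun_arms (K := K) hY hU h).comp hX (hψ.comp (measurable_pi_apply k))
  have hint := hind.integral_fun_mul_eq_mul_integral
    (hX.comp (by fun_prop)).aestronglyMeasurable
    (((hψ.comp (measurable_pi_apply k))).comp (by fun_prop)).aestronglyMeasurable
  have hψint : ∫ x, ψ (U (x k)) ∂iidArms K μ = ∫ y, ψ (U y) ∂μ := by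
    have hmp := measurePreserving_eval (fun _ : Fin K => μ) k
    conv_rhs => rw [← hmp.map_eq]
    exact (integral_map hmp.aemeasurable (hψ.comp hU).aestronglyMeasurable).symm
  rw [← integral_indicator hSm, ← integral_indicator hSm, ← hψint]
  refine Eq.trans (integral_congr_ae (.of_forall fun x => ?_)) hint
  by_cases hx : (fun i => Y (x i)) ∈ S <;> simp [Set.indicator, hx]

/-- On the ordering event a middle score lies between the two extreme ones, so its square is at
most the sum of their squares. -/
lemma sq_le_sq_add_sq_of_strictMono {y : Fin (n + 1) → ℝ} (hy : StrictMono y) (k : Fin (n + 1)) :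
    y k ^ 2 ≤ y 0 ^ 2 + y (Fin.last n) ^ 2 := by
  have h0 := hy.monotone (Fin.zero_le k)
  have hn := hy.monotone (Fin.le_last k)
  rcases le_total 0 (y k) with h | h <;> nlinarith

/-- Suppose that every direction `v` decomposes as `a + b * Y + U`, with `Y` the score in direction
`β` up to a shift, `U` a centred variable independent of `Y`, and `Y` symmetric under a
transformation `T` preserving `μ`. Then the covariance is balanced with constant `2`. -/
theorem scalarBalance_of_decomposition (hμ : MemLp id 2 μ)
    (T : EuclideanSpace ℝ (Fin d) ≃ᵐ EuclideanSpace ℝ (Fin d)) (hT : MeasurePreserving T μ μ)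
    (hdec : ∀ β v : EuclideanSpace ℝ (Fin d), ∃ (c a b e : ℝ) (u : EuclideanSpace ℝ (Fin d)),
      (∀ y, inner ℝ y v = a + b * (inner ℝ y β - c) + (inner ℝ y u - e)) ∧
      IndepFun (fun y => inner ℝ y β - c) (fun y => inner ℝ y u - e) μ ∧
      ∫ y, (inner ℝ y u - e) ∂μ = 0 ∧ ∀ y, inner ℝ (T y) β - c = -(inner ℝ y β - c)) (n : ℕ) :
    ScalarBalance n μ 2 := by
  intro k _ _ β v _
  obtain ⟨c, a, b, e, u, hv, hind, hmean, hTY⟩ := hdec β v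
  set Y : EuclideanSpace ℝ (Fin d) → ℝ := fun y => inner ℝ y β - c with hYdef
  set U : EuclideanSpace ℝ (Fin d) → ℝ := fun y => inner ℝ y u - e with hUdef
  have hY : Measurable Y := by fun_prop
  have hU : Measurable U := by fun_prop
  set P := iidArms (n + 1) μ
  set A : Set (Fin (n + 1) → EuclideanSpace ℝ (Fin d)) := orderEvent 1 β with hA
  have hAY : A = {x | (fun i => Y (x i)) ∈ {y : Fin (n + 1) → ℝ | StrictMono y}} := by
    ext x
    simp [hA, orderEvent, StrictMono, hYdef]
  have hS : MeasurableSet {y : Fin (n + 1) → ℝ | StrictMono y} := by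
    have : {y : Fin (n + 1) → ℝ | StrictMono y} =
        ⋂ (i : Fin (n + 1)) (j : Fin (n + 1)) (_ : i < j), {y | y i < y j} := by
      ext y
      simp only [StrictMono, Set.mem_ofPred_eq, Set.mem_iInter]
    rw [this]
    exact .iInter fun i => .iInter fun j => .iInter fun _ =>
      measurableSet_lt (by fun_prop) (by fun_prop)
  have hAm : MeasurableSet A := measurableSet_orderEvent 1 β
  have hYL (j : Fin (n + 1)) : MemLp (fun x : Fin (n + 1) → EuclideanSpace ℝ (Fin d) => Y (x j)) 2
      (P.restrict A) := ((memLp_inner_arm hμ j β).sub (memLp_const c)).restrict A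
  have hUL (j : Fin (n + 1)) : MemLp (fun x : Fin (n + 1) → EuclideanSpace ℝ (Fin d) => U (x j)) 2
      (P.restrict A) := ((memLp_inner_arm hμ j u).sub (memLp_const e)).restrict A
  have hY1 (j : Fin (n + 1)) := (hYL j).integrable one_le_two
  have hY2 (j : Fin (n + 1)) := (hYL j).integrable_sq
  have hU2 (j : Fin (n + 1)) := (hUL j).integrable_sq
  have hlinL (j : Fin (n + 1)) (a' b' : ℝ) : MemLp (fun x : Fin (n + 1) → EuclideanSpace ℝ (Fin d) =>
      a' + b' * Y (x j)) 2 (P.restrict A) := (memLp_const a').add ((hYL j).const_mul b')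
  set p : ℝ := P.real A
  set s : ℝ := ∫ y, U y ^ 2 ∂μ
  have hs0 : 0 ≤ s := integral_nonneg fun _ => sq_nonneg _
  have hp0 : 0 ≤ p := measureReal_nonneg
  set e₁ : Fin (n + 1) → ℝ := fun j => ∫ x in A, Y (x j) ∂P
  set q : Fin (n + 1) → ℝ := fun j => ∫ x in A, Y (x j) ^ 2 ∂P with hq
  have hlin (j : Fin (n + 1)) (a' b' : ℝ) :
      ∫ x in A, (a' + b' * Y (x j)) ^ 2 ∂P = a' ^ 2 * p + 2 * a' * b' * e₁ j + b' ^ 2 * q j := by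
    have : ∀ x : Fin (n + 1) → EuclideanSpace ℝ (Fin d), (a' + b' * Y (x j)) ^ 2 =
        (a' ^ 2 + 2 * a' * b' * Y (x j)) + b' ^ 2 * Y (x j) ^ 2 := fun x => by ring
    simp_rw [this]
    rw [integral_add (f := fun x => a' ^ 2 + 2 * a' * b' * Y (x j))
        ((integrable_const _).add ((hY1 j).const_mul _)) ((hY2 j).const_mul _),
      integral_add (integrable_const _) ((hY1 j).const_mul _), integral_const_mul,
      integral_const_mul, setIntegral_const, smul_eq_mul, mul_comm p]
  have hcross (j : Fin (n + 1)) : ∫ x in A, (a + b * Y (x j)) * U (x j) ∂P = 0 := by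
    have := setIntegral_mul_of_indep hY hU hind hS (φ := fun t => a + b * t) (ψ := id)
      (by fun_prop) measurable_id j
    rw [← hAY] at this
    rw [show (∫ y, id (U y) ∂μ) = 0 from hmean, mul_zero] at this
    exact this
  have hsq (j : Fin (n + 1)) : ∫ x in A, U (x j) ^ 2 ∂P = p * s := by
    have := setIntegral_mul_of_indep hY hU hind hS (φ := fun _ => 1) (ψ := fun t => t ^ 2)
      (by fun_prop) (by fun_prop) j
    rw [← hAY] at this
    simpa using this
  have hmom (j : Fin (n + 1)) : positionMoment (n + 1) μ β v j =
      a ^ 2 * p + 2 * a * b * e₁ j + b ^ 2 * q j + p * s := by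
    have hexp : ∀ x : Fin (n + 1) → EuclideanSpace ℝ (Fin d), inner ℝ (x j) v ^ 2 =
        ((a + b * Y (x j)) ^ 2 + 2 * ((a + b * Y (x j)) * U (x j))) + U (x j) ^ 2 :=
      fun x => by rw [hv]; simp only [hYdef, hUdef]; ring
    rw [positionMoment]
    simp_rw [hexp]
    have hc : Integrable (fun x : Fin (n + 1) → EuclideanSpace ℝ (Fin d) =>
        2 * ((a + b * Y (x j)) * U (x j))) (P.restrict A) :=
      ((hlinL j a b).integrable_mul (hUL j)).const_mul 2
    rw [integral_add (f := fun x => (a + b * Y (x j)) ^ 2 + 2 * ((a + b * Y (x j)) * U (x j)))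
        ((hlinL j a b).integrable_sq.add hc) (hU2 j),
      integral_add (hlinL j a b).integrable_sq hc, integral_const_mul, hcross, hlin, hsq]
    ring
  -- reversing the order of the arms and applying `T` to each preserves both the law and the event
  have hrev : e₁ 0 = -e₁ (Fin.last n) := by
    have hmp : MeasurePreserving (MeasurableEquiv.arrowCongr' Fin.revPerm T) P P :=
      measurePreserving_arrowCongr' (fun _ => μ) (fun _ => μ) Fin.revPerm T fun _ => hT
    have hap (x : Fin (n + 1) → EuclideanSpace ℝ (Fin d)) (j : Fin (n + 1)) :
        Y (MeasurableEquiv.arrowCongr' Fin.revPerm T x j) = -Y (x j.rev) := hTY (x j.rev)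
    have hpre : MeasurableEquiv.arrowCongr' Fin.revPerm T ⁻¹' A = A := by
      rw [hAY]
      ext x
      simp only [Set.mem_preimage, Set.mem_ofPred_eq, hap]
      constructor
      · intro hx i j hij
        simpa using hx (Fin.rev_lt_rev.2 hij)
      · intro hx i j hij
        exact neg_lt_neg (hx (Fin.rev_lt_rev.2 hij))
    have := hmp.setIntegral_preimage_emb (MeasurableEquiv.measurableEmbedding _)
      (fun x => Y (x 0)) A
    rw [hpre] at this
    simp only [hap, Fin.rev_zero, integral_neg] at this
    exact this.symm
  have hqk : q k ≤ q 0 + q (Fin.last n) := by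
    rw [hq, ← integral_add (hY2 0) (hY2 _)]
    refine setIntegral_mono_on (hY2 k) ((hY2 0).add (hY2 _)) hAm fun x hx => ?_
    rw [hAY] at hx
    exact sq_le_sq_add_sq_of_strictMono (y := fun i => Y (x i)) hx k
  have hamgm : 0 ≤ a ^ 2 * p + 2 * a * -b * e₁ k + (-b) ^ 2 * q k := by
    rw [← hlin k a (-b)]
    exact integral_nonneg fun _ => sq_nonneg _
  have hb := mul_le_mul_of_nonneg_left hqk (sq_nonneg b)
  have hps := mul_nonneg hp0 hs0
  have hap := mul_nonneg (sq_nonneg a) hp0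
  rw [hmom, hmom, hmom, hrev]
  linarith

lemma measurePreserving_multivariateGaussian_reflect (m : EuclideanSpace ℝ (Fin d))
    (Γ : Matrix (Fin d) (Fin d) ℝ) :
    MeasurePreserving (MeasurableEquiv.subLeft ((2 : ℝ) • m)) (multivariateGaussian m Γ)
      (multivariateGaussian m Γ) := by
  refine ⟨MeasurableEquiv.measurable _, ?_⟩
  have hneg := stdGaussian_map (LinearIsometryEquiv.neg ℝ (E := EuclideanSpace ℝ (Fin d)))
  obtain ⟨L, hL⟩ : ∃ L : EuclideanSpace ℝ (Fin d) →L[ℝ] EuclideanSpace ℝ (Fin d),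
      multivariateGaussian m Γ = (stdGaussian _).map fun x => m + L x := ⟨_, rfl⟩
  have hm : Measurable fun x : EuclideanSpace ℝ (Fin d) => m + L x := by fun_prop
  rw [hL, Measure.map_map (MeasurableEquiv.measurable _) hm]
  conv_rhs => rw [← hneg, Measure.map_map hm (LinearIsometryEquiv.continuous _).measurable]
  congr 1
  ext1 x
  change (2 : ℝ) • m - (m + L x) = m + L (-x)
  rw [map_neg, two_smul]
  abel

/-- Gaussian arms have a balanced covariance with constant `2`: the part of `Xᵀv` uncorrelated with
the score `Xᵀβ` is independent of it. -/
theorem scalarBalance_multivariateGaussian (m : EuclideanSpace ℝ (Fin d))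
    {Γ : Matrix (Fin d) (Fin d) ℝ} (hΓ : Γ.PosSemidef) (n : ℕ) :
    ScalarBalance n (multivariateGaussian m Γ) 2 := by
  have hL : MemLp id 2 (multivariateGaussian m Γ) := IsGaussian.memLp_id _ 2 (by simp)
  refine scalarBalance_of_decomposition hL _
    (measurePreserving_multivariateGaussian_reflect m Γ) (fun β v => ?_) n
  -- regression coefficient; if the score is degenerate then every direction is uncorrelated with it
  obtain ⟨b, hb⟩ : ∃ b : ℝ, (β : Fin d → ℝ) ⬝ᵥ Γ.mulVec (v - b • β : EuclideanSpace ℝ (Fin d)) = 0 := by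
    by_cases hq : (β : Fin d → ℝ) ⬝ᵥ Γ.mulVec β = 0
    · refine ⟨0, ?_⟩
      have h0 := (hΓ.dotProduct_mulVec_zero_iff (β : Fin d → ℝ)).1 hq
      have hsymm : Γ.transpose = Γ := by
        rw [← Matrix.conjTranspose_eq_transpose_of_trivial]; exact hΓ.isHermitian
      rw [Matrix.dotProduct_mulVec, ← Matrix.mulVec_transpose, hsymm, h0, zero_dotProduct]
    · refine ⟨(β : Fin d → ℝ) ⬝ᵥ Γ.mulVec v / (β : Fin d → ℝ) ⬝ᵥ Γ.mulVec β, ?_⟩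
      rw [WithLp.ofLp_sub, WithLp.ofLp_smul, Matrix.mulVec_sub, Matrix.mulVec_smul, dotProduct_sub,
        dotProduct_smul, smul_eq_mul, div_mul_cancel₀ _ hq, sub_self]
  set u : EuclideanSpace ℝ (Fin d) := v - b • β with hu
  refine ⟨inner ℝ m β, inner ℝ m v, b, inner ℝ m u, u, fun y => ?_, ?_, ?_, fun y => ?_⟩
  · simp only [hu, inner_sub_right, inner_smul_right]
    ring
  · have hG : HasGaussianLaw (fun y : EuclideanSpace ℝ (Fin d) => (inner ℝ β y, inner ℝ u y))
        (multivariateGaussian m Γ) :=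
      IsGaussian.hasGaussianLaw_id.map ((innerSL ℝ β).prod (innerSL ℝ u))
    have hcov : cov[fun y => inner ℝ β y, fun y => inner ℝ u y; multivariateGaussian m Γ] = 0 := by
      rw [← covarianceBilin_apply_eq_cov hL, covarianceBilin_multivariateGaussian hΓ, hb]
    have := (hG.indepFun_of_covariance_eq_zero hcov).comp
      (measurable_id.sub_const (inner ℝ m β)) (measurable_id.sub_const (inner ℝ m u))
    simpa only [Function.comp_def, id, real_inner_comm β, real_inner_comm u] using this
  · have hi : Integrable (fun y : EuclideanSpace ℝ (Fin d) => y) (multivariateGaussian m Γ) :=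
      hL.integrable one_le_two
    rw [integral_sub (hi.inner_const u) (integrable_const _)]
    simp_rw [real_inner_comm u]
    rw [integral_inner hi, integral_id_multivariateGaussian]
    simp
  · change inner ℝ ((2 : ℝ) • m - y) β - inner ℝ m β = -(inner ℝ y β - inner ℝ m β)
    rw [inner_sub_left, real_inner_smul_left]
    ring

end Gaussian

/-! ### The uniform law on the sphere -/

section Sphere

variable {d K n : ℕ}

open scoped Pointwise ENNReal

/-- The surface measure of `B` is computed from the volume of the truncated cone over its trace on
the sphere. -/
lemma uniformSphere_apply {B : Set (EuclideanSpace ℝ (Fin d))} (hB : MeasurableSet B) :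
    uniformSphere d B = ((volume : Measure (EuclideanSpace ℝ (Fin d))).toSphere Set.univ)⁻¹ *
      (d * volume (Set.Ioo (0 : ℝ) 1 • (Metric.sphere (0 : EuclideanSpace ℝ (Fin d)) 1 ∩ B))) := by
  rw [uniformSphere, Measure.map_apply measurable_subtype_coe hB, Measure.smul_apply, smul_eq_mul,
    Measure.toSphere_apply' _ (measurable_subtype_coe hB), finrank_euclideanSpace_fin,
    Subtype.image_preimage_coe]

lemma isProbabilityMeasure_uniformSphere (hd : 1 ≤ d) : IsProbabilityMeasure (uniformSphere d) := by
  have : Nonempty (Fin d) := ⟨⟨0, hd⟩⟩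
  have : IsProbabilityMeasure
      (((volume : Measure (EuclideanSpace ℝ (Fin d))).toSphere Set.univ)⁻¹ •
        (volume : Measure (EuclideanSpace ℝ (Fin d))).toSphere) :=
    ⟨by
      rw [Measure.smul_apply, smul_eq_mul]
      exact ENNReal.inv_mul_cancel (Measure.measure_univ_ne_zero.2 (Measure.toSphere_ne_zero _))
        (measure_ne_top _ _)⟩
  exact Measure.isProbabilityMeasure_map measurable_subtype_coe.aemeasurable

lemma ae_norm_uniformSphere : ∀ᵐ y ∂uniformSphere d, ‖y‖ = 1 := by
  rw [uniformSphere, ae_map_iff measurable_subtype_coe.aemeasurable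
    (measurableSet_eq_fun (by fun_prop) (by fun_prop))]
  exact .of_forall fun y => by simp

lemma memLp_uniformSphere (hd : 1 ≤ d) : MemLp id 2 (uniformSphere d) := by
  have := isProbabilityMeasure_uniformSphere hd
  exact .of_bound aestronglyMeasurable_id 1 (ae_norm_uniformSphere.mono fun y hy => hy.le)

lemma measurePreserving_uniformSphere
    (R : EuclideanSpace ℝ (Fin d) ≃ₗᵢ[ℝ] EuclideanSpace ℝ (Fin d)) :
    MeasurePreserving R (uniformSphere d) (uniformSphere d) := by
  refine ⟨R.continuous.measurable, Measure.ext fun B hB => ?_⟩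
  have hpre : Set.Ioo (0 : ℝ) 1 • (Metric.sphere (0 : EuclideanSpace ℝ (Fin d)) 1 ∩ R ⁻¹' B) =
      R ⁻¹' (Set.Ioo (0 : ℝ) 1 • (Metric.sphere (0 : EuclideanSpace ℝ (Fin d)) 1 ∩ B)) := by
    ext y
    simp only [Set.mem_smul, Set.mem_preimage, Set.mem_inter_iff, mem_sphere_zero_iff_norm]
    constructor
    · rintro ⟨r, hr, z, ⟨hz, hzB⟩, rfl⟩
      exact ⟨r, hr, R z, ⟨by simpa using hz, hzB⟩, by simp⟩
    · rintro ⟨r, hr, z, ⟨hz, hzB⟩, h⟩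
      exact ⟨r, hr, R.symm z, ⟨by simpa using hz, by simpa using hzB⟩,
        R.injective (by simpa using h)⟩
  rw [Measure.map_apply R.continuous.measurable hB, uniformSphere_apply hB,
    uniformSphere_apply (R.continuous.measurable hB), hpre,
    R.measurePreserving.measure_preimage_emb R.toHomeomorph.measurableEmbedding]

/-- In dimension at least two a circular cone `{y | yᵀβ = c ‖y‖}` has volume zero: away from its
axis it is disjoint from its translates along the axis. -/
lemma volume_cone (hd : 2 ≤ d) {β : EuclideanSpace ℝ (Fin d)} (hβ : β ≠ 0) (c : ℝ) :
    volume {y : EuclideanSpace ℝ (Fin d) | inner ℝ y β = c * ‖y‖} = 0 := by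
  set T : Set (EuclideanSpace ℝ (Fin d)) :=
    {y | inner ℝ y β = c * ‖y‖ ∧ |inner ℝ y β| < ‖y‖ * ‖β‖} with hT
  have hβ' : 0 < ‖β‖ := norm_pos_iff.2 hβ
  have haxis : volume ((ℝ ∙ β : Submodule ℝ (EuclideanSpace ℝ (Fin d))) :
      Set (EuclideanSpace ℝ (Fin d))) = 0 := by
    refine Measure.addHaar_submodule _ _ fun htop => ?_
    have h1 := finrank_span_singleton (K := ℝ) hβ
    rw [htop, finrank_top, finrank_euclideanSpace_fin] at h1
    omega
  have hTm : MeasurableSet T := by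
    refine MeasurableSet.inter (s₁ := {y : EuclideanSpace ℝ (Fin d) | inner ℝ y β = c * ‖y‖})
      (s₂ := {y : EuclideanSpace ℝ (Fin d) | |inner ℝ y β| < ‖y‖ * ‖β‖}) ?_ ?_
    · exact measurableSet_eq_fun (by fun_prop) (by fun_prop)
    · exact measurableSet_lt (by fun_prop) (by fun_prop)
  have hT0 : volume T = 0 := by
    set t : ℕ → ℝ := fun m => 1 / ((m : ℝ) + 1) with ht
    have ht1 (m : ℕ) : |t m| ≤ 1 := by
      rw [abs_of_nonneg (by positivity)]
      exact div_le_one_of_le₀ (by linarith [m.cast_nonneg (α := ℝ)]) (by positivity)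
    refine Measure.addHaar_eq_zero_of_disjoint_translates volume (fun m => t m • β) ?_ ?_ hTm
    · refine isBounded_iff_forall_norm_le.2 ⟨‖β‖, ?_⟩
      rintro _ ⟨m, rfl⟩
      rw [norm_smul]
      exact mul_le_of_le_one_left hβ'.le (ht1 m)
    · intro m m' hm
      simp only [Function.onFun, Set.singleton_add]
      refine Set.disjoint_left.2 ?_
      rintro _ ⟨a, ⟨ha, ha'⟩, rfl⟩ ⟨b, ⟨hb, -⟩, hab⟩
      have hab' : a = b + (t m' - t m) • β := by
        replace hab : t m' • β + b = t m • β + a := hab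
        rw [sub_smul, ← add_sub_assoc, eq_sub_iff_add_eq, add_comm b, hab, add_comm]
      have hs : t m' - t m ≠ 0 := by
        intro h0
        rw [sub_eq_zero, ht] at h0
        simp only [one_div, inv_inj, add_left_inj, Nat.cast_inj] at h0
        exact hm h0.symm
      set s := t m' - t m
      have hinner : c * (‖a‖ - ‖b‖) = s * ‖β‖ ^ 2 := by
        rw [mul_sub, ← ha, ← hb, hab', inner_add_left, real_inner_smul_left,
          real_inner_self_eq_norm_sq]
        ring
      have hnorm : |‖a‖ - ‖b‖| ≤ |s| * ‖β‖ := by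
        refine (abs_norm_sub_norm_le a b).trans ?_
        rw [hab', add_sub_cancel_left, norm_smul, Real.norm_eq_abs]
      have hc : |c| < ‖β‖ := by
        rw [ha, abs_mul, abs_norm, mul_comm] at ha'
        exact lt_of_mul_lt_mul_left ha' (norm_nonneg a)
      have habs := congrArg abs hinner
      rw [abs_mul, abs_mul, abs_of_nonneg (sq_nonneg ‖β‖)] at habs
      have h1 := mul_le_mul_of_nonneg_left hnorm (abs_nonneg c)
      have h2 := mul_lt_mul_of_pos_right hc (mul_pos (abs_pos.2 hs) hβ')
      nlinarith
  refine measure_mono_null (fun y hy => ?_) (measure_union_null hT0 haxis)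
  rcases (abs_real_inner_le_norm y β).lt_or_eq with h | h
  · exact .inl ⟨hy, h⟩
  · right
    rcases eq_or_ne y 0 with rfl | hy0
    · simp
    obtain ⟨r, hr, hr'⟩ := (norm_inner_eq_norm_iff (𝕜 := ℝ) hy0 hβ).1 h
    exact Submodule.mem_span_singleton.2 ⟨r⁻¹, by rw [hr', inv_smul_smul₀ hr]⟩

lemma chargesNoLevel_uniformSphere (hd : 2 ≤ d) {β : EuclideanSpace ℝ (Fin d)} (hβ : β ≠ 0) :
    ChargesNoLevel (uniformSphere d) β := by
  intro c
  rw [uniformSphere_apply (measurableSet_eq_fun (by fun_prop) (by fun_prop)),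
    measure_mono_null _ (volume_cone hd hβ c), mul_zero, mul_zero]
  rintro _ ⟨r, hr, y, ⟨hy, hyc⟩, rfl⟩
  rw [mem_sphere_zero_iff_norm] at hy
  change inner ℝ (r • y) β = c * ‖r • y‖
  rw [real_inner_smul_left, norm_smul, hy, Real.norm_of_nonneg hr.1.le,
    show inner ℝ y β = c from hyc]
  ring

/-- Two vectors of equal length are exchanged by a reflection, which fixes every vector that has the
same inner product with both. -/
lemma exists_isometry_map_eq {E : Type*} [NormedAddCommGroup E] [InnerProductSpace ℝ E]
    {v w : E} (h : ‖v‖ = ‖w‖) : ∃ R : E ≃ₗᵢ[ℝ] E, R v = w ∧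
      ∀ β : E, inner ℝ v β = inner ℝ w β → R β = β := by
  refine ⟨(ℝ ∙ (v - w))ᗮ.reflection, Submodule.reflection_sub h, fun β hβ =>
    Submodule.reflection_mem_subspace_eq_self ?_⟩
  rw [Submodule.mem_orthogonal_singleton_iff_inner_right, inner_sub_left, hβ, sub_self]

/-- By isotropy, each coordinate of a uniform point on the sphere has second moment `1 / d`. -/
lemma lintegral_inner_sq_uniformSphere (hd : 1 ≤ d) {β : EuclideanSpace ℝ (Fin d)}
    (hβ : ‖β‖ = 1) :
    d * ∫⁻ y, ENNReal.ofReal (inner ℝ y β ^ 2) ∂uniformSphere d = 1 := by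
  have := isProbabilityMeasure_uniformSphere hd
  have heq (v : EuclideanSpace ℝ (Fin d)) (hv : ‖v‖ = 1) :
      ∫⁻ y, ENNReal.ofReal (inner ℝ y v ^ 2) ∂uniformSphere d =
        ∫⁻ y, ENNReal.ofReal (inner ℝ y β ^ 2) ∂uniformSphere d := by
    obtain ⟨R, hR, -⟩ := exists_isometry_map_eq (hβ.trans hv.symm)
    rw [← (measurePreserving_uniformSphere R).lintegral_comp (by fun_prop)]
    simp only [← hR, LinearIsometryEquiv.inner_map_map]
  have hb := EuclideanSpace.basisFun (Fin d) ℝ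
  have hsum : ∫⁻ y, ∑ i, ENNReal.ofReal (inner ℝ y (hb i) ^ 2) ∂uniformSphere d = 1 := by
    rw [lintegral_congr_ae (g := fun _ => 1)]
    · simp
    · filter_upwards [ae_norm_uniformSphere] with y hy
      rw [← ENNReal.ofReal_sum_of_nonneg fun _ _ => sq_nonneg _, hb.sum_sq_inner_left, hy]
      simp
  rw [lintegral_finsetSum _ fun i _ => by fun_prop] at hsum
  simpa [heq _ (hb.orthonormal.1 _)] using hsum

lemma positionMoment_map_isometry (hd : 1 ≤ d)
    (R : EuclideanSpace ℝ (Fin d) ≃ₗᵢ[ℝ] EuclideanSpace ℝ (Fin d))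
    {β : EuclideanSpace ℝ (Fin d)} (hβ : R β = β) (v : EuclideanSpace ℝ (Fin d)) (k : Fin K) :
    positionMoment K (uniformSphere d) β (R v) k = positionMoment K (uniformSphere d) β v k := by
  have := isProbabilityMeasure_uniformSphere hd
  have hmp : MeasurePreserving (MeasurableEquiv.arrowCongr' (Equiv.refl (Fin K))
      R.toHomeomorph.toMeasurableEquiv) (iidArms K (uniformSphere d))
      (iidArms K (uniformSphere d)) :=
    measurePreserving_arrowCongr' (fun _ => uniformSphere d) (fun _ => uniformSphere d) _ _
      fun _ => measurePreserving_uniformSphere R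
  have hap (x : Fin K → EuclideanSpace ℝ (Fin d)) (j : Fin K) :
      MeasurableEquiv.arrowCongr' (Equiv.refl (Fin K)) R.toHomeomorph.toMeasurableEquiv x j =
        R (x j) := rfl
  have hpre : MeasurableEquiv.arrowCongr' (Equiv.refl (Fin K)) R.toHomeomorph.toMeasurableEquiv ⁻¹'
      orderEvent 1 β = orderEvent 1 β := by
    ext x
    simp only [orderEvent, Set.mem_preimage, Set.mem_ofPred_eq, hap]
    conv_lhs => rw [← hβ]
    simp only [LinearIsometryEquiv.inner_map_map]
  have h := hmp.setIntegral_preimage_emb (MeasurableEquiv.measurableEmbedding _)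
    (fun x => inner ℝ (x k) (R v) ^ 2) (orderEvent 1 β)
  rw [hpre] at h
  simp only [hap, LinearIsometryEquiv.inner_map_map] at h
  exact h.symm

lemma positionMoment_smul {μ : Measure (EuclideanSpace ℝ (Fin d))} (β v : EuclideanSpace ℝ (Fin d))
    (c : ℝ) (k : Fin K) :
    positionMoment K μ β (c • v) k = c ^ 2 * positionMoment K μ β v k := by
  simp only [positionMoment, real_inner_smul_right, mul_pow]
  exact integral_const_mul _ _

/-- The components along and orthogonal to `β` contribute separately: reflecting the orthogonal
component kills the cross term. -/
lemma positionMoment_add_orthogonal (hd : 1 ≤ d) {β w : EuclideanSpace ℝ (Fin d)}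
    (hw : inner ℝ w β = 0) (c : ℝ) (k : Fin K) :
    positionMoment K (uniformSphere d) β (c • β + w) k =
      c ^ 2 * positionMoment K (uniformSphere d) β β k +
        positionMoment K (uniformSphere d) β w k := by
  have := isProbabilityMeasure_uniformSphere hd
  obtain ⟨R, hR, hRβ⟩ := exists_isometry_map_eq (norm_neg w).symm
  have hβ : R β = β := hRβ β (by rw [inner_neg_left, hw, neg_zero])
  have h1 := positionMoment_map_isometry (K := K) hd R hβ (c • β + w) k
  have hint (v : EuclideanSpace ℝ (Fin d)) : Integrable (fun x : Fin K → EuclideanSpace ℝ (Fin d) =>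
      inner ℝ (x k) v ^ 2) ((iidArms K (uniformSphere d)).restrict (orderEvent 1 β)) :=
    (integrable_inner_arm_sq (memLp_uniformSphere hd) k v).restrict
  have h2 : positionMoment K (uniformSphere d) β (c • β + w) k +
      positionMoment K (uniformSphere d) β (c • β + -w) k =
        2 * (positionMoment K (uniformSphere d) β (c • β) k +
          positionMoment K (uniformSphere d) β w k) := by
    simp only [positionMoment]
    rw [← integral_add (hint _) (hint _), ← integral_add (hint _) (hint _), ← integral_const_mul]
    congr 1 with x
    simp only [inner_add_right, inner_neg_right]
    ring
  rw [map_add, map_smul, hβ, hR] at h1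
  rw [h1, positionMoment_smul] at h2
  linarith

/-- Given the scores, the component of an arm orthogonal to `β` is isotropic, with squared norm
`1 - Z²` for the score `Z`; hence its second moment in one direction is the `(d - 1)`-th part of
that. -/
lemma positionMoment_orthogonal {β w : EuclideanSpace ℝ (Fin d)} (hβ : ‖β‖ = 1) (hd : 1 ≤ d)
    (hw : inner ℝ w β = 0) (k : Fin K) :
    ((d : ℝ) - 1) * positionMoment K (uniformSphere d) β w k =
      ‖w‖ ^ 2 * ((iidArms K (uniformSphere d)).real (orderEvent 1 β) -
        positionMoment K (uniformSphere d) β β k) := by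
  have := isProbabilityMeasure_uniformSphere hd
  set i₀ : Fin d := ⟨0, hd⟩
  obtain ⟨b, hb⟩ := Orthonormal.exists_orthonormalBasis_extension_of_card_eq (𝕜 := ℝ)
    (E := EuclideanSpace ℝ (Fin d)) (ι := Fin d) (by simp) (v := fun _ => β) (s := {i₀})
    ⟨fun _ => hβ, fun i j hij => (hij (Subsingleton.elim i j)).elim⟩
  have hb0 : b i₀ = β := hb i₀ rfl
  have hint (v : EuclideanSpace ℝ (Fin d)) : Integrable (fun x : Fin K → EuclideanSpace ℝ (Fin d) =>
      inner ℝ (x k) v ^ 2) ((iidArms K (uniformSphere d)).restrict (orderEvent 1 β)) :=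
    (integrable_inner_arm_sq (memLp_uniformSphere hd) k v).restrict
  have hsum : ∑ i, positionMoment K (uniformSphere d) β (b i) k =
      (iidArms K (uniformSphere d)).real (orderEvent 1 β) := by
    simp only [positionMoment]
    rw [← integral_finsetSum _ fun i _ => hint _]
    have : ∀ᵐ x ∂(iidArms K (uniformSphere d)).restrict (orderEvent 1 β),
        ∑ i, inner ℝ (x k) (b i) ^ 2 = 1 := by
      refine ae_restrict_of_ae ?_
      filter_upwards [(measurePreserving_eval (fun _ : Fin K => uniformSphere d)
        k).quasiMeasurePreserving.ae ae_norm_uniformSphere] with x hx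
      rw [b.sum_sq_inner_left, show ‖x k‖ = 1 from hx, one_pow]
    rw [integral_congr_ae this]
    simp
  have heach (i : Fin d) (hi : i ∈ Finset.univ.erase i₀) :
      ‖w‖ ^ 2 * positionMoment K (uniformSphere d) β (b i) k =
        positionMoment K (uniformSphere d) β w k := by
    have hbi : inner ℝ (b i) β = 0 := by
      rw [← hb0]; exact b.orthonormal.2 (Finset.ne_of_mem_erase hi)
    obtain ⟨R, hR, hRβ⟩ := exists_isometry_map_eq (v := w) (w := ‖w‖ • b i)
      (by rw [norm_smul, b.orthonormal.1 i, norm_norm, mul_one])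
    rw [← positionMoment_smul, ← hR]
    exact positionMoment_map_isometry hd R
      (hRβ β (by rw [real_inner_smul_left, hbi, hw, mul_zero])) w k
  rw [← Finset.add_sum_erase _ _ (Finset.mem_univ i₀), hb0] at hsum
  rw [← hsum, add_sub_cancel_left, Finset.mul_sum, Finset.sum_congr rfl heach, Finset.sum_const,
    Finset.card_erase_of_mem (Finset.mem_univ _), Finset.card_fin, nsmul_eq_mul, Nat.cast_pred hd]

lemma positionMoment_normalize {μ : Measure (EuclideanSpace ℝ (Fin d))}
    {β : EuclideanSpace ℝ (Fin d)} (hβ : β ≠ 0) (v : EuclideanSpace ℝ (Fin d)) (k : Fin K) :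
    positionMoment K μ (‖β‖⁻¹ • β) v k = positionMoment K μ β v k := by
  have : orderEvent (1 : Equiv.Perm (Fin K)) (‖β‖⁻¹ • β) = orderEvent 1 β := by
    ext x
    simp only [orderEvent, StrictMono, Set.mem_ofPred_eq, real_inner_smul_right,
      mul_lt_mul_iff_right₀ (inv_pos.2 (norm_pos_iff.2 hβ))]
  rw [positionMoment, this, positionMoment]

lemma positionMoment_self_le {μ : Measure (EuclideanSpace ℝ (Fin d))} [IsProbabilityMeasure μ]
    (hμ : MemLp id 2 μ) (β : EuclideanSpace ℝ (Fin d)) (k : Fin (n + 1)) :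
    positionMoment (n + 1) μ β β k ≤
      positionMoment (n + 1) μ β β 0 + positionMoment (n + 1) μ β β (Fin.last n) := by
  have hint (j : Fin (n + 1)) := (integrable_inner_arm_sq hμ j β).restrict (s := orderEvent 1 β)
  simp only [positionMoment]
  rw [← integral_add (hint _) (hint _)]
  exact setIntegral_mono_on (hint k) ((hint 0).add (hint _)) (measurableSet_orderEvent 1 β)
    fun x hx => sq_le_sq_add_sq_of_strictMono (y := fun i => inner ℝ (x i) β) hx k

/-- On the sphere, only directions orthogonal to a normalized `β` have to be compared. -/
lemma scalarBalance_uniformSphere_of_orthogonal (hd : 1 ≤ d)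
    (h : ∀ β w : EuclideanSpace ℝ (Fin d), ‖β‖ = 1 → inner ℝ w β = 0 → ∀ k : Fin (n + 1),
      positionMoment (n + 1) (uniformSphere d) β w k ≤
        positionMoment (n + 1) (uniformSphere d) β w 0 +
          positionMoment (n + 1) (uniformSphere d) β w (Fin.last n)) :
    ScalarBalance n (uniformSphere d) 1 := by
  have := isProbabilityMeasure_uniformSphere hd
  intro k _ _ β v hβ
  rw [one_mul, ← positionMoment_normalize hβ, ← positionMoment_normalize hβ,
    ← positionMoment_normalize hβ]
  have hβ1 : ‖‖β‖⁻¹ • β‖ = 1 := norm_smul_inv_norm (𝕜 := ℝ) hβ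
  generalize ‖β‖⁻¹ • β = γ at hβ1
  set w := v - inner ℝ v γ • γ with hw
  have hwγ : inner ℝ w γ = 0 := by
    rw [hw, inner_sub_left, real_inner_smul_left, real_inner_self_eq_norm_sq, hβ1]
    ring
  have hv : v = inner ℝ v γ • γ + w := by rw [hw]; abel
  rw [hv]
  simp only [positionMoment_add_orthogonal hd hwγ]
  have h1 := h γ w hβ1 hwγ k
  have h2 := mul_le_mul_of_nonneg_left (positionMoment_self_le (memLp_uniformSphere hd) γ k)
    (sq_nonneg (inner ℝ v γ))
  linarith

lemma scalarBalance_uniformSphere_one (n : ℕ) : ScalarBalance n (uniformSphere 1) 1 := by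
  refine scalarBalance_uniformSphere_of_orthogonal le_rfl fun β w hβ hw k => ?_
  have hw0 : w = 0 := by
    have hb0 : β 0 ≠ 0 := by
      intro h
      have : β = 0 := by ext i; rw [Subsingleton.elim i 0, h]; rfl
      simp [this] at hβ
    ext i
    rw [Subsingleton.elim i 0]
    simpa [PiLp.inner_apply, hb0] using hw
  simp [hw0, positionMoment]

/-- When there are at most `d / 2` arms, a union bound shows that the squared scores are at most
`1 / 2` on average, so that every arm retains half of the second moment in the directions
orthogonal to `β`. -/
lemma scalarBalance_uniformSphere_of_le (hd : 2 ≤ d) (hn : 2 * (n + 1) ≤ d) :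
    ScalarBalance n (uniformSphere d) 1 := by
  have hd1 : 1 ≤ d := by omega
  have := isProbabilityMeasure_uniformSphere hd1
  refine scalarBalance_uniformSphere_of_orthogonal hd1 fun β w hβ hw k => ?_
  have hβ0 : β ≠ 0 := norm_ne_zero_iff.1 (by rw [hβ]; exact one_ne_zero)
  have hlevel := chargesNoLevel_uniformSphere hd hβ0
  set p := (iidArms (n + 1) (uniformSphere d)).real (orderEvent 1 β) with hp
  have hfac : (0 : ℝ) < (n + 1).factorial := by exact_mod_cast (n + 1).factorial_pos
  have hpfac : ((n + 1).factorial : ℝ) * p = 1 := by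
    have := congrArg ENNReal.toReal (factorial_mul_measure_orderEvent (K := n + 1) hlevel 0)
    simpa [ENNReal.toReal_mul, hp, measureReal_def] using this
  have hhalf (j : Fin (n + 1)) :
      positionMoment (n + 1) (uniformSphere d) β β j ≤ p / 2 := by
    have h1 := factorial_mul_setLIntegral_le hlevel
      (h := fun y => ENNReal.ofReal (inner ℝ y β ^ 2)) (by fun_prop) j
    rw [← ofReal_positionMoment (memLp_uniformSphere hd1)] at h1
    have h2 := lintegral_inner_sq_uniformSphere hd1 hβ
    set I := ∫⁻ y, ENNReal.ofReal (inner ℝ y β ^ 2) ∂uniformSphere d with hI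
    have hItop : I ≠ ⊤ := by
      rintro htop
      rw [htop, ENNReal.mul_top (by simp; omega)] at h2
      exact ENNReal.top_ne_one h2
    have h1' := ENNReal.toReal_mono (ENNReal.mul_ne_top (by simp) hItop) h1
    have h2' := congrArg ENNReal.toReal h2
    rw [ENNReal.toReal_mul, ENNReal.toReal_mul, ENNReal.toReal_ofReal (positionMoment_nonneg ..),
      ENNReal.toReal_natCast, ENNReal.toReal_natCast] at h1'
    rw [ENNReal.toReal_mul, ENNReal.toReal_natCast, ENNReal.toReal_one] at h2'
    have hcast : 2 * ((n + 1 : ℕ) : ℝ) ≤ d := by exact_mod_cast hn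
    have h3 := mul_le_mul_of_nonneg_right hcast (ENNReal.toReal_nonneg (a := I))
    refine le_of_mul_le_mul_left ?_ hfac
    linarith
  have hd' : (0 : ℝ) < d - 1 := by
    have : (2 : ℝ) ≤ d := by exact_mod_cast hd
    linarith
  refine le_of_mul_le_mul_left ?_ hd'
  rw [mul_add, positionMoment_orthogonal hβ hd1 hw, positionMoment_orthogonal hβ hd1 hw,
    positionMoment_orthogonal hβ hd1 hw, ← mul_add]
  refine mul_le_mul_of_nonneg_left ?_ (sq_nonneg _)
  have h0 := hhalf 0
  have hl := hhalf (Fin.last n)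
  have hk := positionMoment_nonneg (μ := uniformSphere d) β β k
  linarith

lemma exists_scalarBalance_uniformSphere (hd : 1 ≤ d) (n : ℕ) :
    ∃ C, ScalarBalance n (uniformSphere d) C := by
  have := isProbabilityMeasure_uniformSphere hd
  obtain rfl | hd2 := hd.eq_or_lt
  · exact ⟨1, scalarBalance_uniformSphere_one n⟩
  · exact ⟨_, scalarBalance_of_chargesNoLevel (memLp_uniformSphere hd)
      (fun β hβ => chargesNoLevel_uniformSphere hd2 hβ) n⟩

/-- In the regime `K = o(d)` all but finitely many dimensions have the constant `1`. -/
theorem exists_uniform_balancedCovariance_uniformSphere {K : ℕ → ℕ}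
    (hK : (fun d : ℕ => (K d : ℝ)) =o[atTop] (fun d : ℕ => (d : ℝ))) :
    ∃ C : ℝ, ∀ d : ℕ, 1 ≤ d → BalancedCovariance (iidArms (K d) (uniformSphere d)) C := by
  have hev := hK.def (c := 1 / 2) (by norm_num)
  obtain ⟨N, hN⟩ := eventually_atTop.1 hev
  have hC (d : ℕ) : ∃ C : ℝ, 1 ≤ d → ScalarBalance (K d - 1) (uniformSphere d) C := by
    by_cases hd : 1 ≤ d
    · exact (exists_scalarBalance_uniformSphere hd _).imp fun C hC _ => hC
    · exact ⟨0, fun h => absurd h hd⟩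
  choose C hC using hC
  refine ⟨1 + ∑ d ∈ Finset.range (N + 2), |C d|, fun d hd => ?_⟩
  have := isProbabilityMeasure_uniformSphere hd
  have hsum : 0 ≤ ∑ d ∈ Finset.range (N + 2), |C d| := Finset.sum_nonneg fun _ _ => abs_nonneg _
  rcases hKd : K d with _ | n
  · exact balancedCovariance_zero_arms _ _
  refine ScalarBalance.balancedCovariance (memLp_uniformSphere hd) ?_
  by_cases hdN : d < N + 2
  · have h := hC d hd
    rw [hKd, Nat.add_sub_cancel] at h
    refine h.mono ?_
    have := Finset.single_le_sum (f := fun d => |C d|) (fun _ _ => abs_nonneg _)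
      (Finset.mem_range.2 hdN)
    linarith [le_abs_self (C d)]
  · have h := hN d (by omega)
    rw [Real.norm_natCast, Real.norm_natCast, hKd] at h
    refine (scalarBalance_uniformSphere_of_le (by omega) ?_).mono (by linarith)
    have : (2 : ℝ) * ((n + 1 : ℕ) : ℝ) ≤ d := by linarith
    exact_mod_cast this

end Sphere

end BalancedArms

theorem proposition1 :
    -- Gaussian arms: one constant for all `K`, `d`, means and covariance matrices
    (∃ C : ℝ, ∀ (K d : ℕ) (m : EuclideanSpace ℝ (Fin d)) (Γ : Matrix (Fin d) (Fin d) ℝ),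
      Γ.PosSemidef →
        BalancedArms.BalancedCovariance
          (BalancedArms.iidArms K (ProbabilityTheory.multivariateGaussian m Γ)) C) ∧
    -- uniform arms on the unit sphere: bounded constant in the regime `K = o(d)`
    (∀ K : ℕ → ℕ,
      (fun d : ℕ => (K d : ℝ)) =o[Filter.atTop] (fun d : ℕ => (d : ℝ)) →
        ∃ C : ℝ, ∀ d : ℕ, 1 ≤ d →
          BalancedArms.BalancedCovariance
            (BalancedArms.iidArms (K d) (BalancedArms.uniformSphere d)) C) ∧
    -- arbitrary i.i.d. arms whose law charges no affine hyperplane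
    (∀ (K d : ℕ) (μ : MeasureTheory.Measure (EuclideanSpace ℝ (Fin d))),
      MeasureTheory.IsProbabilityMeasure μ →
      MeasureTheory.MemLp (fun x : EuclideanSpace ℝ (Fin d) => x) 2 μ →
      (∀ β : EuclideanSpace ℝ (Fin d), β ≠ 0 → ∀ c : ℝ, μ {x | inner ℝ x β = c} = 0) →
        BalancedArms.BalancedCovariance (BalancedArms.iidArms K μ)
          ((K - 1).choose ⌈((K : ℝ) - 1) / 2⌉₊ : ℝ)) := by
  refine ⟨⟨2, fun K d m Γ hΓ => ?_⟩,
    fun K hK => BalancedArms.exists_uniform_balancedCovariance_uniformSphere hK,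
    fun K d μ _ hμ hlevel => ?_⟩
  · rcases K with _ | n
    · exact BalancedArms.balancedCovariance_zero_arms _ _
    · exact (BalancedArms.scalarBalance_multivariateGaussian m hΓ n).balancedCovariance
        (ProbabilityTheory.IsGaussian.memLp_id _ 2 (by simp))
  · rcases K with _ | n
    · exact BalancedArms.balancedCovariance_zero_arms _ _
    · have h := (BalancedArms.scalarBalance_of_chargesNoLevel hμ hlevel n).balancedCovariance hμ
      rwa [Nat.add_sub_cancel, Nat.cast_succ, add_sub_cancel_right]
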